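/- Let $(X,d)$ be a compact metric space and $\varepsilon>0$. A continuous map $f:X\to Y$ to a topological space $Y$ is called an $\varepsilon$-embedding if $\operatorname{Diam} f^{-1}(y)\le\varepsilon$ for all $y\in Y$. Let $\mathrm{Widim}_\varepsilon(X,d)$ be the minimum integer $m$ such that there exist an $m$-dimensional polyhedron $P$ (the underlying space of a finite simplicial complex) and an $\varepsilon$-embedding $f:X\to P$. For $1\le p<\infty$ put $B_{\ell^p}(\mathbb{R}^n)=\{x\in\mathbb{R}^n : \sum_{k=1}^n |x_k|^p\le 1\}$, and for $1\le q\le\infty$ let $d_{\ell^q}$ be the $\ell^q$-distance on $\mathbb{R}^n$, i.e. $d_{\ell^q}(x,y)=\bigl(\sum_{k=1}^n|x_k-y_k|^q\bigr)^{1/q}$ for $q<\infty$ and $d_{\ell^\infty}(x,y)=\max_k|x_k-y_k|$. Proposition. Let $1\le p<q\le\infty$ ($q$ may be $\infty$) and define $r$ by $1/r=1/p-1/q$ (with $1/\infty=0$). Then for every $\varepsilon>0$ and every integer $n\ge 0$, \[ \min\bigl(n,\ \lceil \varepsilon^{-r}\rceil-1\bigr)\ \le\ \mathrm{Widim}_\varepsilon\bigl(B_{\ell^p}(\mathbb{R}^n),d_{\ell^q}\bigr),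 \] where $\lceil x\rceil$ denotes the smallest integer $\ge x$. -/

import Mathlib

open scoped ENNReal

/-- A continuous map `f : X → Y` is an `ε`-embedding if each of its fibres has diameter at
most `ε`. (The diameter is the `[0, ∞]`-valued one, so an unbounded fibre has diameter `∞`.) -/
def IsEpsEmbedding {X Y : Type*} [MetricSpace X] [TopologicalSpace Y] (ε : ℝ) (f : X → Y) :
    Prop :=
  Continuous f ∧ ∀ y : Y, Metric.ediam (f ⁻¹' {y}) ≤ ENNReal.ofReal ε

/-- The simplicial complex `K` is finite and has dimension `m`: it has an `m`-simplex (a face with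
`m + 1` vertices) and no simplex of larger dimension. Its space `K.space` is then an
`m`-dimensional polyhedron. -/
def IsFiniteOfDim {N : ℕ} (K : Geometry.SimplicialComplex ℝ (EuclideanSpace ℝ (Fin N))) (m : ℕ) :
    Prop :=
  K.faces.Finite ∧ (∃ s ∈ K.faces, s.card = m + 1) ∧ ∀ s ∈ K.faces, s.card ≤ m + 1

/-- The width dimension `Widim_ε X`: the minimum of all `m` such that there are an
`m`-dimensional polyhedron and an `ε`-embedding of `X` into it. -/
noncomputable def Widim (ε : ℝ) (X : Type*) [MetricSpace X] : ℕ :=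
  sInf {m : ℕ | ∃ (N : ℕ) (K : Geometry.SimplicialComplex ℝ (EuclideanSpace ℝ (Fin N))),
    IsFiniteOfDim K m ∧ ∃ f : X → K.space, IsEpsEmbedding ε f}

/-- The closed unit ball of `ℓ^p(ℝⁿ)`, as a subset of `ℝⁿ` equipped with the `ℓ^q`-distance. -/
def lpBall (n : ℕ) (p : ℝ) (q : ℝ≥0∞) : Set (PiLp q (fun _ : Fin n => ℝ)) :=
  {x | ∑ k : Fin n, |x k| ^ p ≤ 1}

open Module MeasureTheory Metric Set Filter Topology
open scoped Manifold

/-! For an integer `0 < m < ε^(-r)` with `m ≤ n`, Hölder puts the `ℓ^q` ball of radius `ρ = m^(-1/r)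
> ε` of an `m`-dimensional coordinate subspace inside the `ℓ^p` ball (`mem_lpBall_of_norm_le`). So
it suffices that such a ball has no `ε`-embedding `f` into a polyhedron of dimension below `m`.

Small fibres give `f` a `C¹` approximate left inverse `g`. Blending `g ∘ f` with the identity near
the boundary gives a self-map fixing everything outside the ball, hence onto
(`surjective_of_eq_self_of_le_norm`). Then `g` maps the polyhedron onto a set with interior, which
its Hausdorff dimension forbids. Surjectivity rests on the no-retraction theorem, proved by a volume
polynomial argument. -/

/-- The retraction of a normed space onto its closed unit ball that is radial outside of it. -/
noncomputable def radialRetraction {E : Type*} [NormedAddCommGroup E] [NormedSpace ℝ E] (x : E) :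
    E :=
  (max 1 ‖x‖)⁻¹ • x

section radialRetraction
variable {E : Type*} [NormedAddCommGroup E] [NormedSpace ℝ E]

lemma radialRetraction_of_le {x : E} (hx : ‖x‖ ≤ 1) : radialRetraction x = x := by
  simp [radialRetraction, max_eq_left hx]

lemma norm_radialRetraction_of_ge {x : E} (hx : 1 ≤ ‖x‖) : ‖radialRetraction x‖ = 1 := by
  have : ‖x‖ ≠ 0 := by positivity
  simp [radialRetraction, max_eq_right hx, norm_smul, this]

lemma norm_radialRetraction_le (x : E) : ‖radialRetraction x‖ ≤ 1 := by
  rcases le_total ‖x‖ 1 with h | h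
  · rwa [radialRetraction_of_le h]
  · exact (norm_radialRetraction_of_ge h).le

lemma lipschitzWith_radialRetraction : LipschitzWith 2 (radialRetraction : E → E) := by
  refine LipschitzWith.of_dist_le_mul fun x y => ?_
  have ha : (1 : ℝ) ≤ max 1 ‖x‖ := le_max_left _ _
  have hb : (1 : ℝ) ≤ max 1 ‖y‖ := le_max_left _ _
  have hy : ‖y‖ ≤ max 1 ‖y‖ := le_max_right _ _
  have hab : |max 1 ‖y‖ - max 1 ‖x‖| ≤ ‖x - y‖ := by
    refine (abs_max_sub_max_le_max 1 ‖y‖ 1 ‖x‖).trans ?_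
    simpa [norm_sub_rev x y] using abs_norm_sub_norm_le y x
  rw [dist_eq_norm, dist_eq_norm, radialRetraction, radialRetraction]
  generalize max 1 ‖x‖ = a at *
  generalize max 1 ‖y‖ = b at *
  -- Change of vector plus change of scale; each costs at most `‖x - y‖`, whence the constant 2.
  have h : a⁻¹ • x - b⁻¹ • y = a⁻¹ • (x - y) + (a⁻¹ * (b - a)) • (b⁻¹ • y) := by
    have ha' : a ≠ 0 := by positivity
    have hb' : b ≠ 0 := by positivity
    match_scalars <;> field_simp
    ring
  have h1 : a⁻¹ ≤ 1 := inv_le_one_of_one_le₀ ha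
  have h2 : ‖b⁻¹ • y‖ ≤ 1 := by
    rw [norm_smul, norm_inv, Real.norm_of_nonneg (by linarith), inv_mul_le_iff₀ (by linarith)]
    simpa
  have h0 : 0 ≤ a⁻¹ := by positivity
  rw [h]
  calc _ ≤ ‖a⁻¹ • (x - y)‖ + ‖(a⁻¹ * (b - a)) • (b⁻¹ • y)‖ := norm_add_le _ _
    _ ≤ 1 * ‖x - y‖ + (1 * ‖x - y‖) * 1 := by
      rw [norm_smul, norm_smul (a⁻¹ * (b - a)), norm_mul, Real.norm_of_nonneg h0, Real.norm_eq_abs]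
      gcongr
    _ = _ := by push_cast; ring

end radialRetraction

/-- The degree bound is uniform in `A`, so the same interpolation nodes serve at every point `x`. -/
lemma LinearMap.exists_polynomial_det_id_add_smul {E : Type*} [AddCommGroup E] [Module ℝ E]
    [FiniteDimensional ℝ E] (A : E →ₗ[ℝ] E) :
    ∃ P : Polynomial ℝ, P.natDegree ≤ finrank ℝ E ∧
      ∀ t : ℝ, P.eval t = LinearMap.det (LinearMap.id + t • A) := by
  let b := Module.finBasis ℝ E
  let M := LinearMap.toMatrix b b A
  refine ⟨Matrix.det ((Polynomial.X : Polynomial ℝ) • M.map Polynomial.C +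
    (1 : Matrix _ _ ℝ).map Polynomial.C), ?_, fun t => ?_⟩
  · simpa using Polynomial.natDegree_det_X_add_C_le M 1
  · rw [← LinearMap.det_toMatrix b, ← Polynomial.coe_evalRingHom, RingHom.map_det]
    congr 1
    ext i j
    simp [M, Matrix.one_apply, apply_ite, add_comm, mul_comm t]

/-! ### No `C¹` retraction onto the sphere -/

section retraction
variable {E : Type*} [NormedAddCommGroup E] [InnerProductSpace ℝ E] [FiniteDimensional ℝ E]

/-- Differentiating `‖r‖² = 1` shows that the range of the derivative is orthogonal to `r x ≠ 0`. -/
lemma det_fderiv_eq_zero_of_norm_eq_one {r : E → E} {x : E} (hr : DifferentiableAt ℝ r x)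
    (h1 : ∀ x, ‖r x‖ = 1) : (fderiv ℝ r x).det = 0 := by
  by_contra hdet
  have hsurj : Function.Surjective (fderiv ℝ r x) := by
    exact (LinearMap.equivOfDetNeZero _ hdet).surjective
  obtain ⟨v, hv⟩ := hsurj (r x)
  have hd : HasFDerivAt (fun y => ‖r y‖ ^ 2) (2 • (innerSL ℝ (r x)).comp (fderiv ℝ r x)) x := by
    simpa using hr.hasFDerivAt.norm_sq
  have hc : HasFDerivAt (fun y => ‖r y‖ ^ 2) (0 : E →L[ℝ] ℝ) x := by
    simp only [h1]; exact hasFDerivAt_const _ _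
  have := congrArg (fun l : E →L[ℝ] ℝ => l v) (hd.unique hc)
  simp [hv, h1] at this

/-- Precomposing `u` with the radial retraction makes it globally Lipschitz, so for small `t` the
perturbed identity is a bijection of `E`. It fixes all points of norm at least 1, hence permutes the
ball. -/
lemma exists_bijOn_closedBall_add_smul {u : E → E} (hu : ContDiff ℝ 1 u)
    (h0 : ∀ x, ‖x‖ = 1 → u x = 0) :
    ∀ᶠ t : ℝ in 𝓝 0, BijOn (fun x => x + t • u x) (closedBall 0 1) (closedBall 0 1) := by
  obtain ⟨L, hL⟩ := hu.contDiffOn.exists_lipschitzOnWith one_ne_zero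
    (convex_closedBall (0 : E) 1) (isCompact_closedBall 0 1)
  have hw : LipschitzWith (L * 2) (fun x => u (radialRetraction x)) := by
    rw [← lipschitzOnWith_univ] at *
    exact hL.comp lipschitzWith_radialRetraction.lipschitzOnWith
      fun x _ => by simpa using norm_radialRetraction_le x
  have ht : ∀ᶠ t : ℝ in 𝓝 0, ‖t‖₊ * (L * 2) < 1 := by
    have : Tendsto (fun t : ℝ => ‖t‖₊ * (L * 2)) (𝓝 0) (𝓝 (‖(0 : ℝ)‖₊ * (L * 2))) :=
      (by fun_prop : Continuous fun t : ℝ => ‖t‖₊ * (L * 2)).tendsto _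
    exact this.eventually_lt_const (by simp)
  filter_upwards [ht] with t ht
  set F : E → E := fun x => x + t • u (radialRetraction x) with hF
  have hA : ApproximatesLinearOn F (ContinuousLinearEquiv.refl ℝ E : E →L[ℝ] E) univ
      (‖t‖₊ * (L * 2)) := by
    intro x _ y _
    have := hw.dist_le_mul x y
    rw [dist_eq_norm, dist_eq_norm] at this
    calc _ = ‖t • (u (radialRetraction x) - u (radialRetraction y))‖ := by
          congr 1; simp [hF, smul_sub]; abel
      _ ≤ ‖t‖ * (↑(L * 2) * ‖x - y‖) := by rw [norm_smul]; gcongr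
      _ = _ := by push_cast; ring
  have hc : Subsingleton E ∨ ‖t‖₊ * (L * 2) <
      ‖((ContinuousLinearEquiv.refl ℝ E).symm : E →L[ℝ] E)‖₊⁻¹ := by
    rcases subsingleton_or_nontrivial E with h | h
    · exact Or.inl h
    · right
      have : ‖((ContinuousLinearEquiv.refl ℝ E).symm : E →L[ℝ] E)‖₊ = 1 := by
        ext; exact ContinuousLinearMap.norm_id
      rwa [this, inv_one]
  have hinj : Function.Injective F := injOn_univ.1 (hA.injOn hc)
  have hsurj : Function.Surjective F := hA.surjective hc
  have hout : ∀ x, 1 ≤ ‖x‖ → F x = x := fun x hx => by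
    simp [hF, h0 _ (norm_radialRetraction_of_ge hx)]
  have heq : EqOn F (fun x => x + t • u x) (closedBall 0 1) := fun x hx => by
    simp [hF, radialRetraction_of_le (by simpa using hx : ‖x‖ ≤ 1)]
  refine BijOn.congr ⟨fun x hx => ?_, hinj.injOn, fun y hy => ?_⟩ heq
  · by_contra hn
    have h1 : 1 < ‖F x‖ := by simpa using hn
    exact hn (by rwa [hinj (hout _ h1.le)])
  · obtain ⟨x, rfl⟩ := hsurj y
    refine ⟨x, ?_, rfl⟩
    by_contra hn
    have h1 : 1 < ‖x‖ := by simpa using hn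
    exact hn (by rwa [hout _ h1.le] at hy)

/-- There is no `C¹` retraction onto the unit sphere: if `u = r - id`, the volume of the image of the
unit ball under `id + t • u` is a polynomial in `t` that is constant for small `t`. -/
theorem not_exists_contDiff_retraction_sphere {r : E → E} (hr : ContDiff ℝ 1 r)
    (h1 : ∀ x, ‖r x‖ = 1) (hid : ∀ x, ‖x‖ = 1 → r x = x) : False := by
  borelize E
  let μ : Measure E := volume
  let B : Set E := closedBall 0 1
  have hB : IsCompact B := isCompact_closedBall 0 1
  let u : E → E := fun x => r x - x
  have hu : ContDiff ℝ 1 u := hr.sub contDiff_id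
  let D : ℝ → E → ℝ := fun t x => (ContinuousLinearMap.id ℝ E + t • fderiv ℝ u x).det
  have hdu : Continuous (fderiv ℝ u) := hu.continuous_fderiv one_ne_zero
  have hD : Continuous (fun p : ℝ × E => D p.1 p.2) :=
    ContinuousLinearMap.continuous_det.comp
      (continuous_const.add (continuous_fst.smul (hdu.comp continuous_snd)))
  have hDint : ∀ t, IntegrableOn (D t) B μ := fun t =>
    (hD.comp (by fun_prop : Continuous fun x : E => (t, x))).continuousOn.integrableOn_compact hB
  have hpos : ∀ᶠ t : ℝ in 𝓝 0, ∀ x ∈ B, 0 < D t x := by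
    refine hB.eventually_forall_of_forall_eventually fun x _ => ?_
    refine hD.continuousAt.eventually_const_lt ?_
    simp [D, ContinuousLinearMap.det]
  have hvol : ∀ᶠ t : ℝ in 𝓝 0, ∫ x in B, D t x ∂μ = μ.real B := by
    filter_upwards [hpos, exists_bijOn_closedBall_add_smul hu
      (fun x hx => by simp [u, hid x hx])] with t ht hbij
    have := integral_image_eq_integral_abs_det_fderiv_smul μ (f := fun x => x + t • u x)
      (f' := fun x => ContinuousLinearMap.id ℝ E + t • fderiv ℝ u x) (s := B)
      hB.measurableSet (fun x _ => (((hasFDerivAt_id x).add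
        ((hu.differentiable one_ne_zero x).hasFDerivAt.const_smul t)).hasFDerivWithinAt))
      hbij.injOn (fun _ => (1 : ℝ))
    rw [hbij.image_eq] at this
    have h2 : ∫ x in B, D t x ∂μ = ∫ x in B, |D t x| • (1 : ℝ) ∂μ :=
      setIntegral_congr_fun hB.measurableSet fun x hx => by simp [abs_of_pos (ht x hx)]
    rw [h2]
    exact this.symm.trans (by simp [B])
  obtain ⟨τ, hτ, hball⟩ := Metric.eventually_nhds_iff.1 hvol
  -- Distinct nodes strictly inside `(0, τ)`, where the volume identity holds.
  let v : ℕ → ℝ := fun j => τ / (j + 2)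
  have hv : ∀ j, ∫ x in B, D (v j) x ∂μ = μ.real B := fun j => hball (by
    have : (0 : ℝ) < j + 2 := by positivity
    rw [dist_zero_right, Real.norm_of_nonneg (by positivity), div_lt_iff₀ this]
    nlinarith [(Nat.cast_nonneg j : (0 : ℝ) ≤ j)])
  have hvinj : Function.Injective v := fun i j hij => by
    have hi : (0 : ℝ) < i + 2 := by positivity
    have hj : (0 : ℝ) < j + 2 := by positivity
    simp only [v] at hij
    rw [div_eq_div_iff hi.ne' hj.ne'] at hij
    have := mul_left_cancel₀ hτ.ne' hij
    exact_mod_cast (by linarith : (i : ℝ) = j)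
  let s := Finset.range (finrank ℝ E + 1)
  -- Weights extrapolating from the nodes to `t = 1`, where the determinant is that of `fderiv ℝ r
  -- x`, namely 0.
  let c : ℕ → ℝ := fun j => (Lagrange.basis s v j).eval 1
  have hc : ∑ j ∈ s, c j = 1 := by
    have := congrArg (Polynomial.eval 1)
      (Lagrange.sum_basis (s := s) (v := v) hvinj.injOn (by simp [s]))
    simpa [Polynomial.eval_finsetSum] using this
  have hinterp : ∀ x, D 1 x = ∑ j ∈ s, c j * D (v j) x := fun x => by
    obtain ⟨P, hdeg, hP⟩ := LinearMap.exists_polynomial_det_id_add_smul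
      (fderiv ℝ u x : E →ₗ[ℝ] E)
    have hP' : ∀ t, P.eval t = D t x := hP
    have := congrArg (Polynomial.eval 1) (Lagrange.eq_interpolate (s := s) (v := v) (f := P)
      hvinj.injOn (lt_of_le_of_lt Polynomial.degree_le_natDegree
        (by simp only [s, Finset.card_range]; exact_mod_cast Nat.lt_succ_of_le hdeg)))
    rw [hP', Lagrange.interpolate_apply, Polynomial.eval_finsetSum] at this
    rw [this]
    exact Finset.sum_congr rfl fun j _ => by simp [hP', c, mul_comm]
  have hzero : ∀ x, D 1 x = 0 := fun x => by
    rw [← det_fderiv_eq_zero_of_norm_eq_one (hr.differentiable one_ne_zero x) h1]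
    simp only [D, one_smul]
    congr 1
    have : fderiv ℝ u x = fderiv ℝ r x - ContinuousLinearMap.id ℝ E :=
      ((hr.differentiable one_ne_zero x).hasFDerivAt.sub (hasFDerivAt_id x)).fderiv
    rw [this]; abel
  have hfin : (0 : ℝ) = μ.real B := by
    calc (0 : ℝ) = ∫ x in B, D 1 x ∂μ := by simp [hzero]
      _ = ∑ j ∈ s, c j * ∫ x in B, D (v j) x ∂μ := by
        simp only [hinterp]
        rw [integral_finsetSum _ fun j _ => (hDint (v j)).const_mul (c j)]
        simp only [integral_const_mul]
      _ = _ := by simp only [hv, ← Finset.sum_mul, hc, one_mul]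
  have : 0 < μ.real B := ENNReal.toReal_pos (measure_closedBall_pos μ 0 one_pos).ne'
    hB.measure_lt_top.ne
  linarith

end retraction

/-! ### Surjectivity of maps fixing a neighbourhood of infinity -/

section surjective

lemma exists_eq_zero_of_eq_self_of_le_norm {E : Type*} [NormedAddCommGroup E]
    [InnerProductSpace ℝ E] [FiniteDimensional ℝ E] {F : E → E} (hF : Continuous F) {R : ℝ}
    (hR : ∀ x, R ≤ ‖x‖ → F x = x) : ∃ x, F x = 0 := by
  by_contra! hne
  -- Smooth `F - id` with error below `‖F x‖`, so that `x + w x` still has no zero, keeping it 0 far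
  -- out.
  obtain ⟨w, hw⟩ := exists_contMDiffMap_forall_mem_convex_of_local_const (𝓘(ℝ, E)) (n := 1)
    (t := fun x => {w : E | ‖w - (F x - x)‖ < ‖F x‖ ∧ (R + 1 ≤ ‖x‖ → w = 0)})
    (fun x => by
      have h1 : Convex ℝ {w : E | ‖w - (F x - x)‖ < ‖F x‖} := by
        have := convex_ball (F x - x) ‖F x‖
        simpa only [ball, dist_eq_norm] using this
      refine h1.inter fun a ha b hb s t _ _ _ h => ?_
      simp [ha h, hb h])
    (fun x => by
      rcases lt_or_ge ‖x‖ (R + 1) with hx | hx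
      · refine ⟨F x - x, ?_⟩
        have h1 : ∀ᶠ y in 𝓝 x, ‖F x - x - (F y - y)‖ < ‖F y‖ :=
          (by fun_prop : Continuous fun y => ‖F x - x - (F y - y)‖).continuousAt.eventually_lt
            hF.norm.continuousAt (by simpa using hne x)
        filter_upwards [h1, continuous_norm.continuousAt.eventually_lt_const hx] with y hy hy'
        exact ⟨hy, fun h => absurd hy' h.not_gt⟩
      · refine ⟨0, ?_⟩
        filter_upwards [continuous_norm.continuousAt.eventually_const_lt
          (show R < ‖x‖ by linarith)] with y hy
        exact ⟨by simpa [hR y hy.le] using hne y, fun _ => rfl⟩)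
  have hwd : ContDiff ℝ 1 w := w.contMDiff.contDiff
  -- Scaling by `ρ` sends the unit sphere to where `w` vanishes.
  let ρ : ℝ := max (R + 1) 1
  have hρ : 0 < ρ := lt_max_of_lt_right one_pos
  let G : E → E := fun x => ρ • x + w (ρ • x)
  have hG : ContDiff ℝ 1 G := by
    have : ContDiff ℝ 1 fun x : E => ρ • x := contDiff_const_smul ρ
    exact this.add (hwd.comp this)
  have hG0 : ∀ x, G x ≠ 0 := fun x h => by
    have h1 := (hw (ρ • x)).1
    rw [eq_neg_of_add_eq_zero_right h, neg_sub_left, sub_add_cancel, norm_neg] at h1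
    exact lt_irrefl _ h1
  refine not_exists_contDiff_retraction_sphere (r := fun x => ‖G x‖⁻¹ • G x)
    (((hG.norm ℝ hG0).inv fun x => norm_ne_zero_iff.2 (hG0 x)).smul hG)
    (fun x => by simp [norm_smul, hG0 x]) fun x hx => ?_
  have hnorm : ‖ρ • x‖ = ρ := by rw [norm_smul, hx, mul_one, Real.norm_of_nonneg hρ.le]
  have : G x = ρ • x := by
    simp only [G]
    rw [(hw (ρ • x)).2 (by rw [hnorm]; exact le_max_left _ _), add_zero]
  rw [this, hnorm, inv_smul_smul₀ hρ.ne']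

/-- A continuous self-map that is the identity outside a bounded set is surjective. -/
theorem surjective_of_eq_self_of_le_norm {V : Type*} [NormedAddCommGroup V] [NormedSpace ℝ V]
    [FiniteDimensional ℝ V] {H : V → V} (hH : Continuous H) {R : ℝ}
    (hR : ∀ x, R ≤ ‖x‖ → H x = x) : Function.Surjective H := by
  intro y
  let e := toEuclidean (E := V)
  obtain ⟨x, hx⟩ := exists_eq_zero_of_eq_self_of_le_norm
    (F := fun x => e (H (e.symm x + y) - y)) (R := ‖(e : V →L[ℝ] EuclideanSpace ℝ (Fin (finrank ℝ V)))‖ * (|R| + ‖y‖) + 1)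
    (by fun_prop) fun x hx => by
      rw [hR, add_sub_cancel_right, e.apply_symm_apply]
      by_contra! hlt
      have h1 : ‖e.symm x‖ < |R| + ‖y‖ := by
        have := norm_sub_le (e.symm x + y) y
        rw [add_sub_cancel_right] at this
        linarith [le_abs_self R]
      have h2 : ‖x‖ ≤ ‖(e : V →L[ℝ] EuclideanSpace ℝ (Fin (finrank ℝ V)))‖ * ‖e.symm x‖ := by
        simpa using (e : V →L[ℝ] EuclideanSpace ℝ (Fin (finrank ℝ V))).le_opNorm (e.symm x)
      have h3 := mul_le_mul_of_nonneg_left h1.le (norm_nonneg (e : V →L[ℝ] EuclideanSpace ℝ (Fin (finrank ℝ V))))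
      linarith
  exact ⟨e.symm x + y, by simpa [sub_eq_zero] using hx⟩

end surjective

/-! ### The dimension obstruction -/

section dimension

lemma dimH_convexHull_le_card {W : Type*} [NormedAddCommGroup W] [NormedSpace ℝ W]
    [FiniteDimensional ℝ W] {s : Finset W} {k : ℕ} (hs : s.card ≤ k + 1) :
    dimH (convexHull ℝ (s : Set W)) ≤ k := by
  rcases s.eq_empty_or_nonempty with rfl | hne
  · simp
  have : Nonempty s := hne.to_subtype
  rw [Real.Convex.dimH_eq_finrank_vectorSpan (convex_convexHull ℝ (s : Set W)) (by simpa using hne),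
    ← direction_affineSpan, affineSpan_convexHull, direction_affineSpan]
  have hspan : finrank ℝ (vectorSpan ℝ (s : Set W)) + 1 ≤ s.card := by
    rw [← Fintype.card_coe, ← Subtype.range_coe (s := (s : Set W))]
    exact finrank_vectorSpan_range_add_one_le ℝ (Subtype.val : s → W)
  exact_mod_cast (by omega : finrank ℝ (vectorSpan ℝ (s : Set W)) ≤ k)

lemma Geometry.SimplicialComplex.dimH_space_le {W : Type*} [NormedAddCommGroup W]
    [NormedSpace ℝ W] [FiniteDimensional ℝ W] {K : Geometry.SimplicialComplex ℝ W}
    (hK : K.faces.Finite) {k : ℕ} (hk : ∀ s ∈ K.faces, s.card ≤ k + 1) : dimH K.space ≤ k := by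
  rw [Geometry.SimplicialComplex.space, dimH_bUnion hK.countable]
  exact iSup₂_le fun s hs => dimH_convexHull_le_card (hk s hs)

/-- The admissible values at `y` form an intersection of balls, hence are convex. A point `c` of the
fibre stays admissible near `y`, because the points of `B` at distance at least `δ` from `c` have
compact image missing `y`. A partition of unity glues these choices. -/
lemma exists_contDiff_norm_sub_le {V W : Type*} [NormedAddCommGroup V] [NormedSpace ℝ V]
    [NormedAddCommGroup W] [NormedSpace ℝ W] [FiniteDimensional ℝ W] {B : Set V}
    (hB : IsCompact B) {F : V → W} (hF : ContinuousOn F B) {ε δ : ℝ} (hεδ : ε < δ)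
    (hfib : ∀ x ∈ B, ∀ y ∈ B, F x = F y → ‖x - y‖ ≤ ε) :
    ∃ g : W → V, ContDiff ℝ 1 g ∧ ∀ x ∈ B, ‖g (F x) - x‖ ≤ δ := by
  obtain ⟨g, hg⟩ := exists_contMDiffMap_forall_mem_convex_of_local_const (𝓘(ℝ, W)) (n := 1)
    (t := fun y => {v : V | ∀ x ∈ B, F x = y → ‖v - x‖ ≤ δ})
    (fun y a ha b hb s t hs ht hst x hx hxy => by
      have := convex_closedBall x δ (mem_closedBall_iff_norm.2 (ha x hx hxy))
        (mem_closedBall_iff_norm.2 (hb x hx hxy)) hs ht hst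
      exact mem_closedBall_iff_norm.1 this)
    (fun y => by
      obtain ⟨c, hc⟩ : ∃ c : V, ∀ x ∈ B, F x = y → ‖c - x‖ ≤ ε := by
        by_cases h : ∃ x ∈ B, F x = y
        · obtain ⟨c, hc, rfl⟩ := h
          exact ⟨c, fun x hx hxy => hfib c hc x hx hxy.symm⟩
        · exact ⟨0, fun x hx hxy => absurd ⟨x, hx, hxy⟩ h⟩
      let C : Set V := B ∩ {x | δ ≤ ‖c - x‖}
      have hC : IsCompact C := hB.inter_right
        (isClosed_le continuous_const (by fun_prop))
      have hFC : IsClosed (F '' C) := (hC.image_of_continuousOn (hF.mono inter_subset_left)).isClosed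
      have hy : y ∉ F '' C := by
        rintro ⟨x, ⟨hx, hx'⟩, hxy⟩
        exact absurd (hc x hx hxy) (not_le.2 (hεδ.trans_le hx'))
      refine ⟨c, ?_⟩
      filter_upwards [hFC.isOpen_compl.mem_nhds hy] with z hz x hx hxz
      by_contra! h
      exact hz ⟨x, ⟨hx, h.le⟩, hxz⟩)
  exact ⟨g, g.contMDiff.contDiff, fun x hx => hg (F x) x hx rfl⟩

/-- A ball of radius `ρ` in a normed space `V` has no `ε`-embedding, `ε < ρ`, into a polyhedron of
dimension less than `dim V`. -/
theorem finrank_le_of_continuous_closedBall_to_space {V W : Type*} [NormedAddCommGroup V]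
    [NormedSpace ℝ V] [FiniteDimensional ℝ V] [NormedAddCommGroup W] [NormedSpace ℝ W]
    [FiniteDimensional ℝ W] {K : Geometry.SimplicialComplex ℝ W} (hK : K.faces.Finite) {k : ℕ}
    (hk : ∀ s ∈ K.faces, s.card ≤ k + 1) {ε ρ : ℝ} (hε : 0 ≤ ε) (hερ : ε < ρ)
    {f : closedBall (0 : V) ρ → K.space} (hf : Continuous f)
    (hfib : ∀ x y, f x = f y → dist x y ≤ ε) : finrank ℝ V ≤ k := by
  have := FiniteDimensional.proper ℝ V
  by_contra! hlt
  obtain ⟨F, hF⟩ := ContinuousMap.exists_restrict_eq (isClosed_closedBall (x := (0 : V)) (ε := ρ))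
    ⟨fun x => (f x : W), by fun_prop⟩
  have hFf : ∀ x (hx : x ∈ closedBall (0 : V) ρ), F x = f ⟨x, hx⟩ := fun x hx =>
    congrArg (fun g : C(closedBall (0 : V) ρ, W) => g ⟨x, hx⟩) hF
  obtain ⟨δ, hεδ, hδρ⟩ := exists_between hερ
  obtain ⟨η, hδη, hηρ⟩ := exists_between hδρ
  obtain ⟨g, hg, hgF⟩ := exists_contDiff_norm_sub_le (isCompact_closedBall (0 : V) ρ)
    F.continuous.continuousOn hεδ fun x hx y hy hxy => by
      have := hfib ⟨x, hx⟩ ⟨y, hy⟩ (Subtype.ext (by rw [← hFf, ← hFf, hxy]))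
      rwa [Subtype.dist_eq, dist_eq_norm] at this
  let χ : V → ℝ := fun x => max 0 (min 1 ((ρ - ‖x‖) / (ρ - η)))
  have hχc : Continuous χ := by fun_prop
  have hχ0 : ∀ x, ρ ≤ ‖x‖ → χ x = 0 := fun x hx =>
    max_eq_left ((min_le_right _ _).trans (div_nonpos_of_nonpos_of_nonneg (by linarith)
      (by linarith)))
  have hχ1 : ∀ x, ‖x‖ ≤ η → χ x = 1 := fun x hx => by
    have : 1 ≤ (ρ - ‖x‖) / (ρ - η) := by rw [one_le_div (by linarith)]; linarith
    simp [χ, min_eq_left this]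
  have hχnn : ∀ x, 0 ≤ χ x := fun x => le_max_left _ _
  have hχle : ∀ x, χ x ≤ 1 := fun x => max_le zero_le_one (min_le_left _ _)
  have hgc := hg.continuous
  have hsurj : Function.Surjective fun x => x + χ x • (g (F x) - x) :=
    surjective_of_eq_self_of_le_norm (by fun_prop) (R := ρ) fun x hx => by simp [hχ0 x hx]
  -- The blended map moves points of the ball by at most `δ`, so preimages of this smaller ball have
  -- norm at most `η`, where the map is exactly `g ∘ F`.
  have hsub : ball (0 : V) (η - δ) ⊆ g '' K.space := fun y hy => by
    obtain ⟨x, rfl⟩ := hsurj y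
    have hy' : ‖x + χ x • (g (F x) - x)‖ < η - δ := by simpa using hy
    have hxρ : ‖x‖ < ρ := by
      by_contra! h
      simp only [hχ0 x h, zero_smul, add_zero] at hy'
      linarith
    have hxB : x ∈ closedBall (0 : V) ρ := by simpa using hxρ.le
    have hxη : ‖x‖ ≤ η := by
      have h1 : ‖χ x • (g (F x) - x)‖ ≤ 1 * δ := by
        rw [norm_smul, Real.norm_of_nonneg (hχnn x)]
        exact mul_le_mul (hχle x) (hgF x hxB) (norm_nonneg _) zero_le_one
      have h2 := norm_sub_le (x + χ x • (g (F x) - x)) (χ x • (g (F x) - x))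
      rw [add_sub_cancel_right] at h2
      linarith
    refine ⟨F x, ?_, by simp [hχ1 x hxη]⟩
    rw [hFf x hxB]
    exact (f ⟨x, hxB⟩).2
  have hdense : Dense (g '' K.space)ᶜ :=
    hg.contDiffOn.dense_compl_image_of_dimH_lt_finrank (t := K.space) convex_univ
      (subset_univ _)
      ((Geometry.SimplicialComplex.dimH_space_le hK hk).trans_lt (by exact_mod_cast hlt))
  obtain ⟨y, hy, hy'⟩ := hdense.exists_mem_open isOpen_ball
    (nonempty_ball.2 (sub_pos.2 hδη) : (ball (0 : V) (η - δ)).Nonempty)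
  exact hy (hsub hy')

end dimension

/-! ### The width dimension is attained -/

lemma exists_isFiniteOfDim_convexHull_subset_space {N m : ℕ}
    {T : Finset (EuclideanSpace ℝ (Fin N))} (hT : AffineIndependent ℝ ((↑) : T → EuclideanSpace ℝ (Fin N)))
    (hcard : T.card = m + 1) :
    ∃ K : Geometry.SimplicialComplex ℝ (EuclideanSpace ℝ (Fin N)),
      IsFiniteOfDim K m ∧ convexHull ℝ (T : Set (EuclideanSpace ℝ (Fin N))) ⊆ K.space := by
  classical
  have hne : T.Nonempty := Finset.card_pos.1 (by omega)
  let K : Geometry.SimplicialComplex ℝ (EuclideanSpace ℝ (Fin N)) :=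
    { faces := {s | s.Nonempty ∧ s ⊆ T}
      isRelLowerSet_faces := fun s hs => ⟨hs.1, fun t hts ht => ⟨ht, hts.trans hs.2⟩⟩
      indep := fun {s} hs => hT.mono (Finset.coe_subset.2 hs.2)
      inter_subset_convexHull := fun {s t} hs ht =>
        (AffineIndependent.convexHull_inter hT hs.2 ht.2).ge }
  have hTK : T ∈ K.faces := ⟨hne, subset_rfl⟩
  refine ⟨K, ⟨T.powerset.finite_toSet.subset fun s hs => Finset.mem_coe.2
    (Finset.mem_powerset.2 hs.2), ⟨T, hTK, hcard⟩, fun s hs => ?_⟩, K.convexHull_subset_space hTK⟩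
  exact (Finset.card_le_card hs.2).trans hcard.le

lemma exists_isFiniteOfDim_closedBall_subset_space (n : ℕ) :
    ∃ K : Geometry.SimplicialComplex ℝ (EuclideanSpace ℝ (Fin n)), IsFiniteOfDim K n ∧
      ∃ c, ∃ s > 0, closedBall c s ⊆ K.space := by
  obtain ⟨b⟩ := AffineBasis.exists_affineBasis_of_finiteDimensional (k := ℝ)
    (P := EuclideanSpace ℝ (Fin n)) (ι := Fin (n + 1)) (by simp)
  let T : Finset (EuclideanSpace ℝ (Fin n)) := Finset.univ.map ⟨b, b.ind.injective⟩
  have hTb : (T : Set (EuclideanSpace ℝ (Fin n))) = range b := by simp [T]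
  have hT : AffineIndependent ℝ ((↑) : T → EuclideanSpace ℝ (Fin n)) := by
    have := b.ind.range
    rw [← hTb] at this
    exact this
  obtain ⟨K, hK, hTK⟩ := exists_isFiniteOfDim_convexHull_subset_space (m := n) hT (by simp [T])
  have hc := b.centroid_mem_interior_convexHull
  rw [← hTb, mem_interior_iff_mem_nhds, Metric.nhds_basis_closedBall.mem_iff] at hc
  obtain ⟨s, hs, hsub⟩ := hc
  exact ⟨K, hK, _, s, hs, hsub.trans hTK⟩

lemma abs_apply_le_one_of_mem_lpBall {n : ℕ} {p : ℝ} (hp : 1 ≤ p) {q : ℝ≥0∞}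
    {x : PiLp q (fun _ : Fin n => ℝ)} (hx : x ∈ lpBall n p q) (k : Fin n) : |x k| ≤ 1 := by
  by_contra! h
  have h1 : 1 < |x k| ^ p := Real.one_lt_rpow h (by linarith)
  have h2 : |x k| ^ p ≤ ∑ k : Fin n, |x k| ^ p :=
    Finset.single_le_sum (f := fun k => |x k| ^ p) (fun i _ => by positivity) (Finset.mem_univ k)
  exact absurd (h2.trans hx) (not_le.2 h1)

/-- This makes the set defining `Widim` nonempty, so its `sInf` is a genuine minimum and not the
default 0. -/
lemma exists_isEpsEmbedding_lpBall (n : ℕ) {p : ℝ} (hp : 1 ≤ p) (q : ℝ≥0∞) [Fact (1 ≤ q)] (ε : ℝ) :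
    ∃ (N : ℕ) (K : Geometry.SimplicialComplex ℝ (EuclideanSpace ℝ (Fin N))),
      IsFiniteOfDim K n ∧ ∃ f : lpBall n p q → K.space, IsEpsEmbedding ε f := by
  obtain ⟨K, hK, c, s, hs, hsub⟩ := exists_isFiniteOfDim_closedBall_subset_space n
  -- The `ℓ^p` ball has Euclidean radius at most `√n`; the `+ 1` covers `n = 0`.
  let a : ℝ := s / (√n + 1)
  have ha : 0 < a := by positivity
  let L : PiLp q (fun _ : Fin n => ℝ) → EuclideanSpace ℝ (Fin n) := fun x => WithLp.toLp 2 x.ofLp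
  have hL : Continuous L := (PiLp.continuous_toLp 2 _).comp (PiLp.continuous_ofLp q _)
  have hLn : ∀ x ∈ lpBall n p q, ‖L x‖ ≤ √n := fun x hx => by
    rw [EuclideanSpace.norm_eq]
    refine Real.sqrt_le_sqrt ?_
    calc ∑ k, ‖L x k‖ ^ 2 ≤ ∑ _k : Fin n, (1 : ℝ) := Finset.sum_le_sum fun k _ =>
          pow_le_one₀ (norm_nonneg _) (abs_apply_le_one_of_mem_lpBall hp hx k)
      _ = n := by simp
  refine ⟨n, K, hK, fun x => ⟨c + a • L x, hsub ?_⟩, ?_, fun y => ?_⟩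
  · rw [mem_closedBall_iff_norm, add_sub_cancel_left, norm_smul, Real.norm_of_nonneg ha.le,
      div_mul_eq_mul_div, div_le_iff₀ (by positivity)]
    exact mul_le_mul_of_nonneg_left ((hLn x x.2).trans (by linarith)) hs.le
  · exact (continuous_const.add ((hL.comp continuous_subtype_val).const_smul a)).subtype_mk _
  · refine le_of_eq_of_le (Metric.ediam_subsingleton fun x hx z hz => ?_) zero_le
    have h := Subtype.ext_iff.1 (hx.trans hz.symm)
    have h2 : L x = L z := smul_right_injective _ ha.ne' (add_left_cancel h)
    exact Subtype.ext (WithLp.ofLp_injective q (WithLp.toLp_injective 2 h2))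

/-! ### Comparison of norms and the conclusion -/

/-- The power mean inequality with exponent `q / p`, applied to `|x k| ^ p`. For `q = ∞`, `toReal`
gives 0 and the factor is the cardinality. -/
lemma PiLp.sum_abs_rpow_le_card_rpow_mul_norm_rpow {ι : Type*} [Fintype ι] {p : ℝ} (hp : 1 ≤ p)
    {q : ℝ≥0∞} [Fact (1 ≤ q)] (hpq : ENNReal.ofReal p < q) (x : PiLp q (fun _ : ι => ℝ))
    (s : Finset ι) :
    ∑ k ∈ s, |x k| ^ p ≤ (s.card : ℝ) ^ (1 - p * q.toReal⁻¹) * ‖x‖ ^ p := by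
  have hp0 : 0 < p := by linarith
  rcases eq_or_ne q ∞ with rfl | hq
  · have : ∀ k ∈ s, |x k| ^ p ≤ ‖x‖ ^ p := fun k _ =>
      Real.rpow_le_rpow (abs_nonneg _) (PiLp.norm_apply_le x k) hp0.le
    simpa using Finset.sum_le_card_nsmul s _ _ this
  · have hpq' : p < q.toReal := (ENNReal.ofReal_lt_iff_lt_toReal hp0.le hq).1 hpq
    have hq0 : 0 < q.toReal := by linarith
    generalize hQ : q.toReal = Q at *
    have hnorm : ∑ k ∈ s, |x k| ^ Q ≤ ‖x‖ ^ Q := by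
      rw [PiLp.norm_eq_sum (by rwa [hQ]), hQ, ← Real.rpow_mul
        (Finset.sum_nonneg fun i _ => by positivity), one_div, inv_mul_cancel₀ hq0.ne',
        Real.rpow_one]
      exact Finset.sum_le_sum_of_subset_of_nonneg (Finset.subset_univ s) fun i _ _ => by positivity
    have h := Real.rpow_sum_le_const_mul_sum_rpow s (fun k => |x k| ^ p)
      (p := Q / p) ((one_le_div hp0).2 hpq'.le)
    have hterm : ∀ k, |(|x k| ^ p)| ^ (Q / p) = |x k| ^ Q := fun k => by
      rw [abs_of_nonneg (by positivity), ← Real.rpow_mul (abs_nonneg _),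
        mul_div_cancel₀ _ hp0.ne']
    simp only [hterm] at h
    simp only [abs_of_nonneg (Real.rpow_nonneg (abs_nonneg _) p)] at h
    have hS : 0 ≤ ∑ k ∈ s, |x k| ^ p := Finset.sum_nonneg fun i _ => by positivity
    have h2 := Real.rpow_le_rpow (by positivity)
      (h.trans (mul_le_mul_of_nonneg_left hnorm (by positivity))) (by positivity : 0 ≤ p / Q)
    rwa [← Real.rpow_mul hS, div_mul_div_cancel₀ hp0.ne', div_self hq0.ne', Real.rpow_one,
      Real.mul_rpow (by positivity) (by positivity), ← Real.rpow_mul (by positivity),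
      ← Real.rpow_mul (by positivity), mul_div_cancel₀ _ hq0.ne', sub_mul, one_mul,
      div_mul_div_cancel₀ hp0.ne', div_self hq0.ne', div_eq_mul_inv] at h2

lemma exists_submodule_finrank_eq_and_apply_eq_zero {m n : ℕ} (hmn : m ≤ n) (q : ℝ≥0∞)
    [Fact (1 ≤ q)] :
    ∃ V : Submodule ℝ (PiLp q (fun _ : Fin n => ℝ)), finrank ℝ V = m ∧
      ∀ x ∈ V, ∀ k : Fin n, m ≤ k → x k = 0 := by
  let L : (Fin m → ℝ) →ₗ[ℝ] PiLp q (fun _ : Fin n => ℝ) :=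
    (WithLp.linearEquiv q ℝ (Fin n → ℝ)).symm.toLinearMap ∘ₗ
      Function.ExtendByZero.linearMap ℝ (Fin.castLE hmn)
  have hL : ∀ v k, L v k = Function.extend (Fin.castLE hmn) v 0 k := fun _ _ => rfl
  refine ⟨LinearMap.range L, ?_, ?_⟩
  · rw [LinearMap.finrank_range_of_inj, finrank_fin_fun]
    intro v w h
    ext k
    have := congrArg (fun x : PiLp q (fun _ : Fin n => ℝ) => x (Fin.castLE hmn k)) h
    simpa only [hL, (Fin.castLE_injective hmn).extend_apply] using this
  · rintro _ ⟨v, rfl⟩ k hk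
    rw [hL, Function.extend_apply']
    · rfl
    · rintro ⟨j, rfl⟩
      exact absurd j.2 (not_lt.2 hk)

lemma mem_lpBall_of_norm_le {n m : ℕ} {p : ℝ} (hp : 1 ≤ p) {q : ℝ≥0∞} [Fact (1 ≤ q)]
    (hpq : ENNReal.ofReal p < q) {r : ℝ} (hr : 1 / r = 1 / p - (1 / q).toReal) (hmn : m ≤ n)
    (hm : 0 < m) {x : PiLp q (fun _ : Fin n => ℝ)} (hx0 : ∀ k : Fin n, m ≤ k → x k = 0)
    (hx : ‖x‖ ≤ (m : ℝ) ^ (-(1 / r))) : x ∈ lpBall n p q := by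
  have hp0 : 0 < p := by linarith
  have hm0 : (0 : ℝ) < m := by exact_mod_cast hm
  let s : Finset (Fin n) := Finset.univ.filter fun k => (k : ℕ) < m
  have hs : s.card = m := by simp [s, Fin.card_filter_val_lt, hmn]
  have hsum : ∑ k, |x k| ^ p = ∑ k ∈ s, |x k| ^ p := by
    refine (Finset.sum_subset (Finset.subset_univ s) fun k _ hk => ?_).symm
    rw [hx0 k (by simpa [s] using hk), abs_zero, Real.zero_rpow hp0.ne']
  have h := PiLp.sum_abs_rpow_le_card_rpow_mul_norm_rpow hp hpq x s
  -- Since `p / r = 1 - p / q`, this power of `m` cancels the Hölder factor.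
  have h2 : ‖x‖ ^ p ≤ (m : ℝ) ^ (-(1 - p * q.toReal⁻¹)) := by
    refine (Real.rpow_le_rpow (norm_nonneg _) hx hp0.le).trans_eq ?_
    rw [← Real.rpow_mul hm0.le, hr, one_div q, ENNReal.toReal_inv]
    congr 1
    field_simp
  change ∑ k, |x k| ^ p ≤ 1
  rw [hsum]
  refine h.trans ((mul_le_mul_of_nonneg_left h2 (by positivity)).trans_eq ?_)
  rw [hs, ← Real.rpow_add hm0, add_neg_cancel, Real.rpow_zero]

theorem mainTheorem4 (n : ℕ) (p : ℝ) (q : ℝ≥0∞) [Fact (1 ≤ q)] (hp : 1 ≤ p)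
    (hpq : ENNReal.ofReal p < q) (r : ℝ) (hr : 1 / r = 1 / p - (1 / q).toReal)
    (ε : ℝ) (hε : 0 < ε) :
    min (n : ℤ) (⌈ε ^ (-r)⌉ - 1) ≤ (Widim ε (lpBall n p q) : ℤ) := by
  obtain ⟨N, K, ⟨hKfin, -, hKcard⟩, f, hf, hfib⟩ : Widim ε (lpBall n p q) ∈ {m : ℕ |
      ∃ (N : ℕ) (K : Geometry.SimplicialComplex ℝ (EuclideanSpace ℝ (Fin N))),
        IsFiniteOfDim K m ∧ ∃ f : lpBall n p q → K.space, IsEpsEmbedding ε f} :=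
    Nat.sInf_mem ⟨n, exists_isEpsEmbedding_lpBall n hp q ε⟩
  rcases le_or_gt (min (n : ℤ) (⌈ε ^ (-r)⌉ - 1)) 0 with h0 | h0
  · exact h0.trans (Nat.cast_nonneg _)
  obtain ⟨m, hm⟩ := Int.eq_ofNat_of_zero_le h0.le
  have hm0 : 0 < m := by omega
  have hmn : m ≤ n := by
    have := min_le_left (n : ℤ) (⌈ε ^ (-r)⌉ - 1)
    omega
  have hmε : (m : ℝ) < ε ^ (-r) := by
    have : (m : ℤ) < ⌈ε ^ (-r)⌉ := by
      have := min_le_right (n : ℤ) (⌈ε ^ (-r)⌉ - 1)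
      omega
    simpa using Int.lt_ceil.1 this
  have hr0 : 0 < r := by
    rw [← one_div_pos, hr, one_div q, ENNReal.toReal_inv, sub_pos, ← one_div]
    rcases eq_or_ne q ∞ with rfl | hq
    · simpa using (by linarith : 0 < p)
    · exact one_div_lt_one_div_of_lt (by linarith)
        ((ENNReal.ofReal_lt_iff_lt_toReal (by linarith) hq).1 hpq)
  -- Strict because `m ≤ ⌈ε ^ (-r)⌉ - 1` means `m < ε ^ (-r)`.
  have hερ : ε < (m : ℝ) ^ (-(1 / r)) := by
    have hm1 : (0 : ℝ) < m := by exact_mod_cast hm0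
    have := Real.rpow_lt_rpow_of_neg hm1 hmε (neg_lt_zero.2 (one_div_pos.2 hr0))
    rwa [← Real.rpow_mul hε.le, neg_mul_neg, mul_one_div_cancel hr0.ne', Real.rpow_one] at this
  obtain ⟨V, hV, hV0⟩ := exists_submodule_finrank_eq_and_apply_eq_zero hmn q
  let j : closedBall (0 : V) ((m : ℝ) ^ (-(1 / r))) → lpBall n p q := fun x =>
    ⟨x.1.1, mem_lpBall_of_norm_le hp hpq hr hmn hm0 (hV0 _ x.1.2) (by simpa using x.2)⟩
  have hj : Continuous j := by fun_prop
  have := finrank_le_of_continuous_closedBall_to_space hKfin hKcard hε.le hερ (f := f ∘ j)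
    (hf.comp hj) fun x y hxy => by
      have h1 : edist (j x) (j y) ≤ ENNReal.ofReal ε :=
        (Metric.edist_le_ediam_of_mem (s := f ⁻¹' {f (j x)}) rfl hxy.symm).trans (hfib _)
      rw [edist_dist] at h1
      exact (ENNReal.ofReal_le_ofReal_iff hε.le).1 h1
  rw [hm, ← hV]
  exact_mod_cast this
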